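/- Let $N\in\mathbb N$, $N_C\in\mathbb N$, and let $\mathcal X\subseteq\mathbb R^N$ be a nonempty closed convex set. Let $\mathbf H\in\mathbb R^{N\times N}$ be an invertible matrix with smallest singular value $\sigma_{\min}$, let $\mathbf y\in\mathbb R^N$, $\lambda>0$, $\mathbf W_1,\dots,\mathbf W_{N_C}\in\mathbb R^{N\times N}$, and let $\tilde{\boldsymbol\Lambda}=(\tilde{\boldsymbol\Lambda}_c)_{c=1}^{N_C}\colon\mathbb R^N\to([0,1]^N)^{N_C}$ be continuous. For $\mathbf z,\mathbf x\in\mathbb R^N$ put $$J(\mathbf z,\mathbf x)=\tfrac12\|\mathbf H\mathbf z-\mathbf y\|_2^2+\lambda\sum_{c=1}^{N_C}\bigl\langle\tilde{\boldsymbol\Lambda}_c(\mathbf x),|\mathbf W_c\mathbf z|\bigr\rangle,$$ where $|\cdot|$ is applied componentwise. Then, for every $\mathbf x\in\mathcal X$, the function $J(\cdot,\mathbf x)$ has exactly one minimizer $T(\mathbf x)$ over $\mathcal X$, so that $T\colon\mathcal X\to\mathcal X$ is well defined. If $\mathbf 0\in\mathcal X$, then $T$ maps $\mathcal X$ into the closed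 ball centered at $\mathbf 0$ with radius $2\|\mathbf y\|_2/\sigma_{\min}$. Moreover, $T$ is continuous on $\mathcal X$, and it has a fixed point, that is, there is $\mathbf x^*\in\mathcal X$ with $T(\mathbf x^*)=\mathbf x^*$. -/

import Mathlib

/-- The smallest of the `N` singular values of a real `N × N` matrix, regarded as a linear map of
the Euclidean space `ℝ^N`. -/
noncomputable def sigmaMin {N : ℕ} (H : Matrix (Fin N) (Fin N) ℝ) : ℝ :=
  ⨅ i : Fin N, (Matrix.toEuclideanLin H).singularValues i

/-- The SAFI objective
`J(z, x) = ½ ‖H z - y‖² + lam * ∑_c ⟨Λ_c(x), |W_c z|⟩`, where `|·|` acts componentwise. -/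
noncomputable def safiObjective {N NC : ℕ} (H : Matrix (Fin N) (Fin N) ℝ)
    (y : EuclideanSpace ℝ (Fin N)) (lam : ℝ) (W : Fin NC → Matrix (Fin N) (Fin N) ℝ)
    (Λ : EuclideanSpace ℝ (Fin N) → Fin NC → Fin N → ℝ)
    (z x : EuclideanSpace ℝ (Fin N)) : ℝ :=
  1 / 2 * ‖Matrix.toEuclideanLin H z - y‖ ^ 2
    + lam * ∑ c, ∑ i, Λ x c i * |Matrix.toEuclideanLin (W c) z i|

/-- The set `argmin_{z ∈ X} J(z, x)`. -/
def safiArgmin {N NC : ℕ} (X : Set (EuclideanSpace ℝ (Fin N))) (H : Matrix (Fin N) (Fin N) ℝ)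
    (y : EuclideanSpace ℝ (Fin N)) (lam : ℝ) (W : Fin NC → Matrix (Fin N) (Fin N) ℝ)
    (Λ : EuclideanSpace ℝ (Fin N) → Fin NC → Fin N → ℝ)
    (x : EuclideanSpace ℝ (Fin N)) : Set (EuclideanSpace ℝ (Fin N)) :=
  {z | z ∈ X ∧ ∀ w ∈ X, safiObjective H y lam W Λ z x ≤ safiObjective H y lam W Λ w x}

/-- The SAFI update operator: `T(x)` is a chosen element of `argmin_{z ∈ X} J(z, x)`. It is the
unique one whenever that set is a singleton (and it is meaningless if the set is empty). -/
noncomputable def safiUpdate {N NC : ℕ} (X : Set (EuclideanSpace ℝ (Fin N)))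
    (H : Matrix (Fin N) (Fin N) ℝ)
    (y : EuclideanSpace ℝ (Fin N)) (lam : ℝ) (W : Fin NC → Matrix (Fin N) (Fin N) ℝ)
    (Λ : EuclideanSpace ℝ (Fin N) → Fin NC → Fin N → ℝ)
    (x : EuclideanSpace ℝ (Fin N)) : EuclideanSpace ℝ (Fin N) :=
  Classical.epsilon fun z => z ∈ safiArgmin X H y lam W Λ x

/-! Since `H` is bounded below, the quadratic term makes `J(·, x)` strongly convex and coercive, so
it has one minimizer on `X`. The parallelogram identity makes this quantitative: `J` grows
quadratically away from a minimizer (`safiObjective_add_le_of_mem_safiArgmin`). Adding the growth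
bounds for two parameters bounds the distance between their minimizers by a constant times the ℓ¹
distance of the weights, so `T` inherits continuity from `Λ`. Comparing the minimizer with a fixed
point of `X` bounds the range of `T`, because the weights are at most 1; comparing it with 0 gives
the explicit radius. As `T` is defined and continuous on the whole space with values in `X`,
Brouwer's theorem for bounded continuous maps gives a fixed point, which lies in `X`. Brouwer itself
follows from the analytic no-retraction theorem: for a retraction `f`, the integral of `det (1 + t
(Df - 1))` over the ball is a polynomial in `t`, equal to the volume for small `t > 0`, yet zero at
`t = 1`. -/

/-! ### Brouwer's fixed point theorem -/

section Brouwer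

open Metric Set Filter Topology MeasureTheory

variable {E : Type*} [NormedAddCommGroup E] [InnerProductSpace ℝ E]

/-- A perturbation of the identity of norm less than one has positive determinant. -/
theorem ContinuousLinearMap.det_one_add_pos [CompleteSpace E] {A : E →L[ℝ] E}
    (hA : ‖A‖ < 1) :
    0 < (1 + A).det := by
  have hcont : Continuous fun s : ℝ => (1 + s • A).det :=
    ContinuousLinearMap.continuous_det.comp (by fun_prop)
  -- By the Neumann series no map on the segment from `1` to `1 + A` is singular, so the determinant
  -- keeps the sign it has at `1`.
  have hne : ∀ s ∈ Icc (0 : ℝ) 1, (1 + s • A).det ≠ 0 := by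
    intro s hs h0
    have hu : IsUnit (1 + s • A) := by
      have : ‖-(s • A)‖ < 1 := by
        rw [norm_neg, norm_smul, Real.norm_of_nonneg hs.1]
        nlinarith [hs.1, hs.2, norm_nonneg A]
      simpa using isUnit_one_sub_of_norm_lt_one this
    obtain ⟨B, hB⟩ := hu.exists_right_inv
    have hmul := congrArg (fun L : E →L[ℝ] E => LinearMap.det (L : E →ₗ[ℝ] E)) hB
    have h0' : LinearMap.det ((1 + s • A : E →L[ℝ] E) : E →ₗ[ℝ] E) = 0 := h0
    simp only [ContinuousLinearMap.toLinearMap_mul, map_mul, h0', zero_mul,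
      ContinuousLinearMap.toLinearMap_one, map_one] at hmul
    exact zero_ne_one hmul
  by_contra! hle
  have h1 : (0 : ℝ) ∈ Icc ((1 + (1 : ℝ) • A).det) ((1 + (0 : ℝ) • A).det) := by
    refine ⟨by simpa using hle, ?_⟩
    simp only [zero_smul, add_zero]
    change 0 ≤ LinearMap.det (LinearMap.id : E →ₗ[ℝ] E)
    simp
  obtain ⟨s, hs, h0⟩ := intermediate_value_Icc' zero_le_one hcont.continuousOn h1
  exact hne s hs h0

variable [FiniteDimensional ℝ E]

/-- Lagrange interpolation of the polynomial `t ↦ det (1 + t A)`. -/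
theorem ContinuousLinearMap.det_one_add_eq_sum_basis (A : E →L[ℝ] E)
    {v : Fin (Module.finrank ℝ E + 1) → ℝ} (hv : Function.Injective v) :
    (1 + A).det =
      ∑ i, (Lagrange.basis Finset.univ v i).eval 1 * (1 + v i • A).det := by
  classical
  let b := Module.finBasis ℝ E
  let M := LinearMap.toMatrix b b (A : E →ₗ[ℝ] E)
  let p : Polynomial ℝ := Matrix.det (1 + (Polynomial.X : Polynomial ℝ) • M.map Polynomial.C)
  have hdet : ∀ t : ℝ, p.eval t = (1 + t • A).det := by
    intro t
    have : (1 + t • A).det = LinearMap.det ((1 : E →ₗ[ℝ] E) + t • (A : E →ₗ[ℝ] E)) := rfl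
    rw [this, ← LinearMap.det_toMatrix b, ← Polynomial.coe_evalRingHom, RingHom.map_det]
    congr 1
    ext i j
    by_cases hij : i = j
    · simp [M, hij, LinearMap.toMatrix_one]
      ring
    · simp [M, hij, LinearMap.toMatrix_one]
      ring
  have hdeg : p.degree < (Finset.univ : Finset (Fin (Module.finrank ℝ E + 1))).card := by
    have h := Polynomial.natDegree_det_X_add_C_le M 1
    have hp : p = Matrix.det ((Polynomial.X : Polynomial ℝ) • M.map Polynomial.C
        + (1 : Matrix _ _ ℝ).map Polynomial.C) := by
      simp [p, add_comm]
    rw [← hp] at h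
    refine lt_of_le_of_lt Polynomial.degree_le_natDegree ?_
    simp only [Fintype.card_fin, Finset.card_univ] at h ⊢
    exact_mod_cast Nat.lt_succ_of_le h
  have h := congrArg (Polynomial.eval 1) (Lagrange.eq_interpolate hv.injOn hdeg)
  rw [Lagrange.interpolate_apply, Polynomial.eval_finsetSum, hdet] at h
  simpa [hdet, mul_comm] using h

/-- A small Lipschitz perturbation of the identity that fixes the sphere and preserves the closed
ball maps the open ball onto itself. -/
theorem image_ball_eq_of_lipschitzOnWith {R : ℝ} {g : E → E} {K : NNReal} (hK : K < 1)
    (hg : LipschitzOnWith K g (closedBall 0 R)) (hsph : ∀ x ∈ sphere (0 : E) R, g x = 0)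
    (hmaps : ∀ x ∈ closedBall (0 : E) R, x + g x ∈ closedBall (0 : E) R) :
    InjOn (fun x => x + g x) (ball 0 R) ∧ (fun x => x + g x) '' ball 0 R = ball 0 R := by
  set h : E → E := fun x => x + g x
  have happ : ApproximatesLinearOn h ((ContinuousLinearEquiv.refl ℝ E : E ≃L[ℝ] E) : E →L[ℝ] E)
      (closedBall 0 R) K := by
    intro x hx y hy
    have := hg.norm_sub_le hx hy
    simpa [h, add_sub_add_comm] using this
  have happ' := happ.mono_set ball_subset_closedBall
  have hc : Subsingleton E ∨
      K < ‖((ContinuousLinearEquiv.refl ℝ E).symm : E →L[ℝ] E)‖₊⁻¹ := by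
    rcases subsingleton_or_nontrivial E with hE | hE
    · exact Or.inl hE
    · right
      have : ‖((ContinuousLinearEquiv.refl ℝ E).symm : E →L[ℝ] E)‖₊ = 1 := by
        ext
        exact ContinuousLinearMap.norm_id
      rw [this]
      simpa using hK
  refine ⟨happ'.injOn hc, ?_⟩
  have hopen : IsOpen (h '' ball 0 R) :=
    happ'.open_image (ContinuousLinearEquiv.refl ℝ E).toNonlinearRightInverse isOpen_ball hc
  rcases le_or_gt R 0 with hR | hR
  · simp [ball_eq_empty.2 hR]
  have hsub : h '' ball 0 R ⊆ ball 0 R := by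
    rw [← interior_closedBall (0 : E) hR.ne']
    refine interior_maximal ?_ (by rwa [interior_closedBall (0 : E) hR.ne'])
    rintro _ ⟨x, hx, rfl⟩
    exact hmaps x (interior_subset hx)
  refine hsub.antisymm ?_
  have hclosed : IsClosed (h '' closedBall 0 R) :=
    ((isCompact_closedBall (0 : E) R).image_of_continuousOn happ.continuousOn).isClosed
  -- The image is open, and relatively closed in the ball: a limit of image points is the image of a
  -- point of the closed ball, and sphere points are fixed, so they do not land inside.
  have hpre : IsPreconnected (ball (0 : E) R) := (convex_ball 0 R).isPreconnected
  refine hpre.subset_of_closure_inter_subset hopen ⟨h 0, hsub ⟨0, by simpa using hR, rfl⟩,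
    ⟨0, by simpa using hR, rfl⟩⟩ ?_
  rintro y ⟨hy, hyb⟩
  obtain ⟨x, hx, rfl⟩ := closure_minimal (image_mono ball_subset_closedBall) hclosed hy
  refine ⟨x, ?_, rfl⟩
  rw [mem_closedBall_zero_iff] at hx
  rw [mem_ball_zero_iff]
  refine lt_of_le_of_ne hx fun hxR => ?_
  have : h x = x := by simp [h, hsph x (by simpa using hxR)]
  rw [this, mem_ball_zero_iff] at hyb
  exact hyb.ne hxR

/-- There is no continuously differentiable retraction of a ball onto its boundary sphere. -/
theorem not_contDiffOn_retraction {R : ℝ} (hR : 0 < R) {f : E → E} {U : Set E} (hU : IsOpen U)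
    (hBU : closedBall 0 R ⊆ U) (hf : ContDiffOn ℝ 1 f U)
    (hmem : ∀ x ∈ closedBall (0 : E) R, ‖f x‖ = R)
    (hid : ∀ x ∈ sphere (0 : E) R, f x = x) : False := by
  borelize E
  let μ : Measure E := Measure.addHaar
  let g : E → E := fun x => f x - x
  let A : E → E →L[ℝ] E := fun x => fderiv ℝ g x
  have hgC : ContDiffOn ℝ 1 g U := hf.sub contDiffOn_id
  have hgd : ∀ x ∈ closedBall (0 : E) R, HasFDerivAt g (A x) x := fun x hx =>
    ((hgC.differentiableOn one_ne_zero).differentiableAt (hU.mem_nhds (hBU hx))).hasFDerivAt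
  have hAcont : ContinuousOn A (closedBall 0 R) :=
    (hgC.continuousOn_fderiv_of_isOpen hU le_rfl).mono hBU
  obtain ⟨C, hC⟩ := (isCompact_closedBall (0 : E) R).exists_bound_of_continuousOn hAcont
  let K : NNReal := ⟨max C 0 + 1, by positivity⟩
  have hKpos : (0 : ℝ) < K := by change 0 < max C 0 + 1; positivity
  have hAK : ∀ x ∈ closedBall (0 : E) R, ‖A x‖ ≤ K := fun x hx =>
    (hC x hx).trans (by change C ≤ max C 0 + 1; linarith [le_max_left C 0])
  have hlip : LipschitzOnWith K g (closedBall 0 R) :=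
    (convex_closedBall (0 : E) R).lipschitzOnWith_of_nnnorm_hasFDerivWithin_le
      (fun x hx => (hgd x hx).hasFDerivWithinAt) hAK
  have hdetInt : ∀ t : ℝ, IntegrableOn (fun x => (1 + t • A x).det) (ball 0 R) μ := by
    intro t
    refine (ContinuousOn.integrableOn_compact (isCompact_closedBall (0 : E) R) ?_).mono_set
      ball_subset_closedBall
    exact ContinuousLinearMap.continuous_det.comp_continuousOn
      (continuousOn_const.add (hAcont.const_smul t))
  have hsmall : ∀ t : ℝ, 0 < t → t * K < 1 → t ≤ 1 →
      ∫ x in ball 0 R, (1 + t • A x).det ∂μ = μ.real (ball 0 R) := by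
    intro t ht htK ht1
    have hK1 : t.toNNReal * K < 1 := by
      rw [← NNReal.coe_lt_coe]
      simpa [ht.le] using htK
    have hl : LipschitzOnWith (t.toNNReal * K) (fun x => t • g x) (closedBall 0 R) := by
      refine LipschitzOnWith.of_dist_le_mul fun x hx y hy => ?_
      rw [dist_eq_norm, ← smul_sub, norm_smul, Real.norm_of_nonneg ht.le, NNReal.coe_mul,
        Real.coe_toNNReal t ht.le, mul_assoc]
      exact mul_le_mul_of_nonneg_left (by simpa [dist_eq_norm] using hlip.dist_le_mul x hx y hy)
        ht.le
    obtain ⟨hinj, himg⟩ := image_ball_eq_of_lipschitzOnWith hK1 hl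
      (fun x hx => by simp [g, hid x hx]) (fun x hx => by
        have : x + t • g x = (1 - t) • x + t • f x := by simp only [g]; module
        rw [this]
        exact (convex_closedBall (0 : E) R) hx (by simp [hmem x hx])
          (by linarith) ht.le (by ring))
    have hcv := integral_image_eq_integral_abs_det_fderiv_smul (f := fun x => x + t • g x)
      (f' := fun x => 1 + t • A x) μ
      (measurableSet_ball (x := (0 : E)) (ε := R)) (fun x hx => by
        have := (hasFDerivAt_id x).add ((hgd x (ball_subset_closedBall hx)).const_smul t)
        exact this.hasFDerivWithinAt) hinj (fun _ => (1 : ℝ))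
    rw [himg] at hcv
    simp only [smul_eq_mul, mul_one, integral_const, measureReal_restrict_apply_univ] at hcv
    rw [hcv]
    refine setIntegral_congr_fun measurableSet_ball fun x hx => ?_
    refine (abs_of_pos (ContinuousLinearMap.det_one_add_pos ?_)).symm
    rw [norm_smul, Real.norm_of_nonneg ht.le]
    exact (mul_le_mul_of_nonneg_left (hAK x (ball_subset_closedBall hx)) ht.le).trans_lt htK
  -- As `‖f‖²` is constant, `f x` is orthogonal to the range of `Df x = 1 + A x`; were that map
  -- onto, `f x` would be orthogonal to itself.
  have hone : ∀ x ∈ ball (0 : E) R, (1 + A x).det = 0 := by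
    intro x hx
    have hfd : HasFDerivAt f (1 + A x) x := by
      have := (hasFDerivAt_id x).add (hgd x (ball_subset_closedBall hx))
      refine this.congr_of_eventuallyEq (Eventually.of_forall fun y => by simp [g])
    have hn : HasFDerivAt (fun y => ‖f y‖ ^ 2) (0 : E →L[ℝ] ℝ) x := by
      refine (hasFDerivAt_const (R ^ 2) x).congr_of_eventuallyEq ?_
      filter_upwards [isOpen_ball.mem_nhds hx] with y hy
      simp [hmem y (ball_subset_closedBall hy)]
    have huniq := hn.unique hfd.norm_sq
    by_contra hdet
    obtain ⟨v, hv⟩ := (LinearMap.equivOfDetNeZero _ hdet).surjective (f x)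
    have hv' : (1 + A x) v = f x := hv
    have h0 : (0 : ℝ) = 2 • inner ℝ (f x) ((1 + A x) v) := DFunLike.congr_fun huniq v
    rw [hv', real_inner_self_eq_norm_sq, hmem x (ball_subset_closedBall hx), two_smul] at h0
    nlinarith
  let n := Module.finrank ℝ E
  -- Distinct nodes, all small enough for `hsmall`; `n + 1` of them determine a polynomial of degree
  -- at most `n`.
  let v : Fin (n + 1) → ℝ := fun i => 1 / ((K + 1) * ((i : ℕ) + 1 + 1))
  have hv : Function.Injective v := by
    intro i j hij
    have h1 : (0 : ℝ) < K + 1 := by positivity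
    simp only [v, one_div] at hij
    have := mul_left_cancel₀ h1.ne' (inv_injective hij)
    ext
    exact_mod_cast (by linarith : ((i : ℕ) : ℝ) = (j : ℕ))
  have hvi : ∀ i, ∫ x in ball 0 R, (1 + v i • A x).det ∂μ = μ.real (ball 0 R) := by
    intro i
    have hd : (0 : ℝ) < (K + 1) * ((i : ℕ) + 1 + 1) := by positivity
    have hi : (0 : ℝ) ≤ (i : ℕ) := by positivity
    refine hsmall _ (by positivity) ?_ ?_
    · rw [div_mul_eq_mul_div, div_lt_one hd]
      nlinarith [mul_nonneg hKpos.le hi]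
    · rw [div_le_one hd]
      nlinarith [mul_nonneg hKpos.le hi]
  have hzero : ∫ x in ball 0 R, (1 + A x).det ∂μ = 0 := by
    rw [setIntegral_congr_fun measurableSet_ball hone]
    simp
  have hvol : ∫ x in ball 0 R, (1 + A x).det ∂μ = μ.real (ball 0 R) := by
    rw [funext fun x => ContinuousLinearMap.det_one_add_eq_sum_basis (A x) hv]
    rw [integral_finsetSum _ fun i _ => (hdetInt (v i)).const_mul _]
    simp_rw [integral_const_mul, hvi]
    rw [← Finset.sum_mul, ← Polynomial.eval_finsetSum,
      Lagrange.sum_basis hv.injOn Finset.univ_nonempty]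
    simp
  have hpos : 0 < μ.real (ball 0 R) :=
    ENNReal.toReal_pos (measure_ball_pos μ 0 hR).ne' measure_ball_lt_top.ne
  exact hpos.ne' (hvol.symm.trans hzero)

/-- A smooth bounded self-map of a Euclidean space has a fixed point. -/
theorem exists_isFixedPt_of_contDiff_of_norm_le {g : E → E} (hg : ContDiff ℝ 1 g) {R : ℝ}
    (hR : ∀ x, ‖g x‖ ≤ R) : ∃ x, Function.IsFixedPt g x := by
  by_contra! hfix
  have hR0 : 0 ≤ R := (norm_nonneg _).trans (hR 0)
  -- Strictly larger than `R`, so that `⟨x, x - g x⟩ > 0` on the sphere of radius `r`.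
  let r := R + 1
  have hr : 0 < r := by positivity
  let u : E → E := fun x => x - g x
  have hu : ∀ x, u x ≠ 0 := fun x h => hfix x (sub_eq_zero.1 h).symm
  have hu2 : ∀ x, 0 < ‖u x‖ ^ 2 := fun x => by have := norm_pos_iff.2 (hu x); positivity
  let p : E → ℝ := fun x => inner ℝ x (u x)
  let D : E → ℝ := fun x => p x ^ 2 + ‖u x‖ ^ 2 * (r ^ 2 - ‖x‖ ^ 2)
  have huC : ContDiff ℝ 1 u := contDiff_id.sub hg
  have hpC : ContDiff ℝ 1 p := contDiff_id.inner ℝ huC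
  have hDC : ContDiff ℝ 1 D :=
    (hpC.pow 2).add ((huC.norm_sq ℝ).mul (contDiff_const.sub (contDiff_id.norm_sq ℝ)))
  -- The larger root of `‖x + s • u x‖² = r²`: `f x` is where the ray from `g x` through `x` leaves
  -- the ball. Positivity of `D` keeps the square root smooth.
  let s : E → ℝ := fun x => (-p x + √(D x)) / ‖u x‖ ^ 2
  let f : E → E := fun x => x + s x • u x
  have hpsph : ∀ x, ‖x‖ = r → 0 < p x := by
    intro x hx
    have h1 : p x = r ^ 2 - inner ℝ x (g x) := by
      simp [p, u, inner_sub_right, hx]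
    have h2 : inner ℝ x (g x) ≤ r * R := by
      refine (real_inner_le_norm x (g x)).trans ?_
      rw [hx]
      exact mul_le_mul_of_nonneg_left (hR x) hr.le
    rw [h1]
    nlinarith
  have hD : ∀ x ∈ closedBall (0 : E) r, 0 < D x := by
    intro x hx
    rw [mem_closedBall_zero_iff] at hx
    rcases hx.lt_or_eq with hlt | heq
    · have : 0 < r ^ 2 - ‖x‖ ^ 2 := by nlinarith [norm_nonneg x]
      have := mul_pos (hu2 x) this
      positivity
    · have := hpsph x heq
      simp only [D, heq, sub_self, mul_zero, add_zero]
      positivity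
  refine not_contDiffOn_retraction hr (f := f) (U := {x | 0 < D x})
    (isOpen_lt continuous_const hDC.continuous) hD ?_ ?_ ?_
  · refine contDiffOn_id.add (ContDiffOn.smul ?_ huC.contDiffOn)
    refine ContDiffOn.div (hpC.neg.contDiffOn.add ?_) (huC.norm_sq ℝ).contDiffOn
      fun x _ => (hu2 x).ne'
    exact hDC.contDiffOn.sqrt fun x hx => ne_of_gt hx
  · intro x hx
    have hq : s x * ‖u x‖ ^ 2 = -p x + √(D x) := div_mul_cancel₀ _ (hu2 x).ne'
    have hsq := Real.sq_sqrt (hD x hx).le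
    have hexp : ‖f x‖ ^ 2 = ‖x‖ ^ 2 + 2 * (s x * p x) + s x ^ 2 * ‖u x‖ ^ 2 := by
      simp only [f]
      rw [norm_add_sq_real, inner_smul_right, norm_smul, mul_pow, Real.norm_eq_abs, sq_abs]
    have hfin : ‖f x‖ ^ 2 = r ^ 2 := by
      have h1 : ‖u x‖ ^ 2 * (‖f x‖ ^ 2 - r ^ 2) = 0 := by
        have e1 : ‖u x‖ ^ 2 * (‖f x‖ ^ 2 - r ^ 2)
            = (s x * ‖u x‖ ^ 2 + p x) ^ 2 - D x := by
          rw [hexp]; simp only [D]; ring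
        rw [e1, hq]
        linear_combination hsq
      linarith [(mul_eq_zero.1 h1).resolve_left (hu2 x).ne']
    exact (sq_eq_sq₀ (norm_nonneg _) hr.le).1 hfin
  · intro x hx
    rw [mem_sphere_zero_iff_norm] at hx
    have hs : s x = 0 := by
      simp [s, D, hx, Real.sqrt_sq (hpsph x hx).le]
    simp [f, hs]

open scoped Manifold ContDiff in
/-- **Brouwer's fixed point theorem** for bounded continuous self-maps of a Euclidean space. -/
theorem exists_isFixedPt_of_continuous_of_norm_le {T : E → E} (hT : Continuous T) {R : ℝ}
    (hR : ∀ x, ‖T x‖ ≤ R) : ∃ x, Function.IsFixedPt T x := by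
  by_contra! hfix
  -- A selection `g` from `t` is closer to `T x` than `x` is, hence has no fixed point; the second
  -- factor keeps it bounded. Near `x` the constant `T x` is a valid local choice.
  let t : E → Set E := fun x => ball (T x) (dist (T x) x) ∩ closedBall 0 R
  obtain ⟨g, hg⟩ := exists_contMDiffMap_forall_mem_convex_of_local_const (n := 1) 𝓘(ℝ, E)
    (t := t) (fun x => (convex_ball _ _).inter (convex_closedBall _ _)) (fun x => by
      refine ⟨T x, ?_⟩
      have h1 : ∀ᶠ y in 𝓝 x, dist (T x) (T y) < dist (T y) y := by
        refine ContinuousAt.eventually_lt (by fun_prop) (by fun_prop) ?_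
        rw [dist_self]
        exact dist_pos.2 (hfix x)
      filter_upwards [h1] with y hy
      exact ⟨hy, by simpa using hR x⟩)
  obtain ⟨x, hx⟩ := exists_isFixedPt_of_contDiff_of_norm_le (g := g) g.contMDiff.contDiff
    (fun x => mem_closedBall_zero_iff.1 (hg x).2)
  have := (hg x).1
  rw [hx, mem_ball, dist_comm] at this
  exact lt_irrefl _ this

end Brouwer

/-! ### Lower bounds from singular values -/

section SingularValues

/-- A linear map stretches every vector at least by any lower bound of its singular values. -/
theorem LinearMap.mul_norm_le_norm_of_le_singularValues {E F : Type*} [NormedAddCommGroup E]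
    [InnerProductSpace ℝ E] [FiniteDimensional ℝ E] [NormedAddCommGroup F] [InnerProductSpace ℝ F]
    [FiniteDimensional ℝ F] (T : E →ₗ[ℝ] F) {s : ℝ} (hs : 0 ≤ s)
    (h : ∀ i < Module.finrank ℝ E, s ≤ T.singularValues i) (z : E) : s * ‖z‖ ≤ ‖T z‖ := by
  -- In an orthonormal eigenbasis of `T* T`, whose eigenvalues are the squared singular values, the
  -- claim is a termwise comparison.
  let hS := T.isSymmetric_adjoint_comp_self
  let b := hS.eigenvectorBasis rfl
  have hT : ‖T z‖ ^ 2 =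
      ∑ i : Fin (Module.finrank ℝ E), T.singularValues i ^ 2 * inner ℝ (b i) z ^ 2 := by
    have h1 : ‖T z‖ ^ 2 = inner ℝ z ((LinearMap.adjoint T ∘ₗ T) z) := by
      rw [LinearMap.comp_apply, LinearMap.adjoint_inner_right, real_inner_self_eq_norm_sq]
    rw [h1, ← b.sum_inner_mul_inner]
    refine Finset.sum_congr rfl fun i _ => ?_
    rw [← hS (b i) z, hS.apply_eigenvectorBasis, T.sq_singularValues_fin rfl i, inner_smul_left,
      real_inner_comm z]
    simp only [RCLike.ofReal_real_eq_id, id_eq, conj_trivial]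
    change inner ℝ z (b i) * (_ * inner ℝ z (b i)) = _ * inner ℝ z (b i) ^ 2
    ring
  have hz : ‖z‖ ^ 2 = ∑ i, inner ℝ (b i) z ^ 2 := by
    rw [← b.sum_sq_norm_inner_right z]
    simp
  refine abs_le_of_sq_le_sq' ?_ (norm_nonneg _) |>.2
  rw [mul_pow, hT, hz, Finset.mul_sum]
  refine Finset.sum_le_sum fun i _ => ?_
  have := h i i.2
  gcongr

variable {N : ℕ} {H : Matrix (Fin N) (Fin N) ℝ}

theorem sigmaMin_nonneg : 0 ≤ sigmaMin H :=
  Real.iInf_nonneg fun _ => LinearMap.singularValues_nonneg _ _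

theorem sigmaMin_mul_norm_le (z : EuclideanSpace ℝ (Fin N)) :
    sigmaMin H * ‖z‖ ≤ ‖Matrix.toEuclideanLin H z‖ := by
  refine LinearMap.mul_norm_le_norm_of_le_singularValues _ sigmaMin_nonneg (fun i hi => ?_) z
  rw [finrank_euclideanSpace_fin] at hi
  exact ciInf_le (Set.finite_range fun i : Fin N =>
    (Matrix.toEuclideanLin H).singularValues i).bddBelow ⟨i, hi⟩

theorem sigmaMin_pos [NeZero N] (hH : IsUnit H) : 0 < sigmaMin H := by
  obtain ⟨i, hi⟩ := exists_eq_ciInf_of_finite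
    (f := fun i : Fin N => (Matrix.toEuclideanLin H).singularValues i)
  rw [sigmaMin, ← hi]
  refine (LinearMap.injective_iff_forall_lt_finrank_singularValues_pos _).1 ?_ i (by simp)
  intro v w hvw
  have := Matrix.mulVec_injective_of_isUnit hH
    (congrArg WithLp.ofLp hvw)
  exact WithLp.ofLp_injective 2 this

/-- An invertible matrix is bounded below. -/
theorem exists_pos_mul_norm_le (hH : IsUnit H) :
    ∃ c > 0, ∀ z : EuclideanSpace ℝ (Fin N), c * ‖z‖ ≤ ‖Matrix.toEuclideanLin H z‖ := by
  -- For `N = 0` the infimum `sigmaMin H` is over an empty family and equals 0, so another constant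
  -- is needed.
  rcases Nat.eq_zero_or_pos N with rfl | hN
  · exact ⟨1, one_pos, fun z => by simp [Subsingleton.elim z 0]⟩
  · have : NeZero N := ⟨hN.ne'⟩
    exact ⟨sigmaMin H, sigmaMin_pos hH, sigmaMin_mul_norm_le⟩

end SingularValues

/-! ### Minimizers of the objective and their dependence on the weights -/

section Objective

open Set Filter Topology

variable {N NC : ℕ} {X : Set (EuclideanSpace ℝ (Fin N))} {H : Matrix (Fin N) (Fin N) ℝ}
  {y : EuclideanSpace ℝ (Fin N)} {lam : ℝ} {W : Fin NC → Matrix (Fin N) (Fin N) ℝ}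
  {Λ : EuclideanSpace ℝ (Fin N) → Fin NC → Fin N → ℝ}

theorem continuous_safiObjective (x : EuclideanSpace ℝ (Fin N)) :
    Continuous fun z => safiObjective H y lam W Λ z x := by
  have hH : Continuous (Matrix.toEuclideanLin H) := LinearMap.continuous_of_finiteDimensional _
  have hW : ∀ c, Continuous (Matrix.toEuclideanLin (W c)) := fun c =>
    LinearMap.continuous_of_finiteDimensional _
  unfold safiObjective
  fun_prop

theorem half_sq_le_safiObjective (hlam : 0 ≤ lam) (hΛ : ∀ x c i, 0 ≤ Λ x c i)
    (z x : EuclideanSpace ℝ (Fin N)) :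
    1 / 2 * ‖Matrix.toEuclideanLin H z - y‖ ^ 2 ≤ safiObjective H y lam W Λ z x := by
  have : 0 ≤ ∑ c, ∑ i, Λ x c i * |Matrix.toEuclideanLin (W c) z i| :=
    Finset.sum_nonneg fun c _ => Finset.sum_nonneg fun i _ => mul_nonneg (hΛ x c i) (abs_nonneg _)
  unfold safiObjective
  linarith [mul_nonneg hlam this]

/-- Sublevel sets of the objective are bounded, uniformly in the weights. -/
theorem norm_apply_le_of_safiObjective_le (hlam : 0 ≤ lam) (hΛ : ∀ x c i, 0 ≤ Λ x c i)
    {z x : EuclideanSpace ℝ (Fin N)} {M : ℝ} (h : safiObjective H y lam W Λ z x ≤ 1 / 2 * M ^ 2)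
    (hM : 0 ≤ M) : ‖Matrix.toEuclideanLin H z‖ ≤ ‖y‖ + M := by
  have h1 := (half_sq_le_safiObjective (H := H) (y := y) (W := W) hlam hΛ z x).trans h
  have h2 : ‖Matrix.toEuclideanLin H z - y‖ ≤ M := (abs_le_of_sq_le_sq' (by linarith) hM).2
  have h3 := norm_add_le (Matrix.toEuclideanLin H z - y) y
  rw [sub_add_cancel] at h3
  linarith

/-- The parallelogram identity gives the exact gain of the quadratic term; the weighted absolute
values are merely convex. -/
theorem safiObjective_midpoint_le (hlam : 0 ≤ lam) (hΛ : ∀ x c i, 0 ≤ Λ x c i)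
    (z w x : EuclideanSpace ℝ (Fin N)) :
    safiObjective H y lam W Λ ((1 / 2 : ℝ) • (z + w)) x ≤
      1 / 2 * safiObjective H y lam W Λ z x + 1 / 2 * safiObjective H y lam W Λ w x
        - 1 / 8 * ‖Matrix.toEuclideanLin H (z - w)‖ ^ 2 := by
  have hquad : ‖Matrix.toEuclideanLin H ((1 / 2 : ℝ) • (z + w)) - y‖ ^ 2 =
      1 / 2 * ‖Matrix.toEuclideanLin H z - y‖ ^ 2 + 1 / 2 * ‖Matrix.toEuclideanLin H w - y‖ ^ 2
        - 1 / 4 * ‖Matrix.toEuclideanLin H (z - w)‖ ^ 2 := by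
    set a := Matrix.toEuclideanLin H z - y with ha
    set b := Matrix.toEuclideanLin H w - y with hb
    have h1 : Matrix.toEuclideanLin H ((1 / 2 : ℝ) • (z + w)) - y = (1 / 2 : ℝ) • (a + b) := by
      rw [ha, hb, map_smul, map_add]
      module
    have h2 : Matrix.toEuclideanLin H (z - w) = a - b := by
      rw [ha, hb, map_sub]
      abel
    rw [h1, h2, norm_smul, mul_pow, norm_add_sq_real a b, norm_sub_sq_real a b]
    norm_num
    ring
  have habs : ∑ c, ∑ i, Λ x c i * |Matrix.toEuclideanLin (W c) ((1 / 2 : ℝ) • (z + w)) i| ≤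
      1 / 2 * ∑ c, ∑ i, Λ x c i * |Matrix.toEuclideanLin (W c) z i| +
        1 / 2 * ∑ c, ∑ i, Λ x c i * |Matrix.toEuclideanLin (W c) w i| := by
    simp only [Finset.mul_sum, ← Finset.sum_add_distrib]
    refine Finset.sum_le_sum fun c _ => Finset.sum_le_sum fun i _ => ?_
    have h1 : |Matrix.toEuclideanLin (W c) ((1 / 2 : ℝ) • (z + w)) i| ≤
        1 / 2 * |Matrix.toEuclideanLin (W c) z i| + 1 / 2 * |Matrix.toEuclideanLin (W c) w i| := by
      rw [map_smul, map_add, PiLp.smul_apply, PiLp.add_apply, smul_eq_mul, abs_mul,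
        abs_of_pos (by norm_num : (0 : ℝ) < 1 / 2)]
      linarith [abs_add_le (Matrix.toEuclideanLin (W c) z i) (Matrix.toEuclideanLin (W c) w i)]
    linarith [mul_le_mul_of_nonneg_left h1 (hΛ x c i)]
  unfold safiObjective
  rw [hquad]
  linarith [mul_le_mul_of_nonneg_left habs hlam]

/-- Quadratic growth of the objective away from a minimizer. -/
theorem safiObjective_add_le_of_mem_safiArgmin (hX : Convex ℝ X) (hlam : 0 ≤ lam)
    (hΛ : ∀ x c i, 0 ≤ Λ x c i) {z w x : EuclideanSpace ℝ (Fin N)}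
    (hz : z ∈ safiArgmin X H y lam W Λ x) (hw : w ∈ X) :
    safiObjective H y lam W Λ z x + 1 / 4 * ‖Matrix.toEuclideanLin H (z - w)‖ ^ 2 ≤
      safiObjective H y lam W Λ w x := by
  have hm : (1 / 2 : ℝ) • (z + w) ∈ X := by
    rw [smul_add]
    exact hX hz.1 hw (by norm_num) (by norm_num) (by norm_num)
  have h1 := hz.2 _ hm
  have h2 := safiObjective_midpoint_le (H := H) (y := y) (W := W) hlam hΛ z w x
  linarith

/-- Coercivity: outside a large ball the objective exceeds its value at a chosen `x₀ ∈ X`. -/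
theorem safiArgmin_nonempty (hXclosed : IsClosed X) (hXne : X.Nonempty) (hH : IsUnit H)
    (hlam : 0 ≤ lam) (hΛ : ∀ x c i, 0 ≤ Λ x c i) (x : EuclideanSpace ℝ (Fin N)) :
    (safiArgmin X H y lam W Λ x).Nonempty := by
  obtain ⟨x₀, hx₀⟩ := hXne
  obtain ⟨c, hc, hcH⟩ := exists_pos_mul_norm_le hH
  set J := safiObjective H y lam W Λ x₀ x
  have hJ0 : 0 ≤ J := le_trans (by positivity) (half_sq_le_safiObjective hlam hΛ x₀ x)
  obtain ⟨z, hz, hmin⟩ := (continuous_safiObjective (H := H) (y := y) (lam := lam) (W := W)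
    (Λ := Λ) x).continuousOn.exists_isMinOn' hXclosed hx₀ (by
      refine Filter.Eventually.filter_mono inf_le_left ?_
      have hlarge := tendsto_norm_cocompact_atTop (E := EuclideanSpace ℝ (Fin N))
      filter_upwards [hlarge.eventually_gt_atTop ((‖y‖ + √(2 * J)) / c)] with w hw
      by_contra! hlt
      have hle := norm_apply_le_of_safiObjective_le (H := H) (y := y) (W := W) (z := w) (x := x)
        hlam hΛ (M := √(2 * J)) (by
        rw [Real.sq_sqrt (by positivity)]
        linarith) (Real.sqrt_nonneg _)
      rw [div_lt_iff₀ hc] at hw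
      linarith [hcH w])
  exact ⟨z, hz, fun w hw => hmin hw⟩

theorem safiUpdate_mem_safiArgmin (hXclosed : IsClosed X) (hXne : X.Nonempty) (hH : IsUnit H)
    (hlam : 0 ≤ lam) (hΛ : ∀ x c i, 0 ≤ Λ x c i) (x : EuclideanSpace ℝ (Fin N)) :
    safiUpdate X H y lam W Λ x ∈ safiArgmin X H y lam W Λ x :=
  Classical.epsilon_spec (safiArgmin_nonempty hXclosed hXne hH hlam hΛ x)

theorem eq_of_mem_safiArgmin (hX : Convex ℝ X) (hH : IsUnit H) (hlam : 0 ≤ lam)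
    (hΛ : ∀ x c i, 0 ≤ Λ x c i) {z w x : EuclideanSpace ℝ (Fin N)}
    (hz : z ∈ safiArgmin X H y lam W Λ x) (hw : w ∈ safiArgmin X H y lam W Λ x) : z = w := by
  obtain ⟨c, hc, hcH⟩ := exists_pos_mul_norm_le hH
  have h1 := safiObjective_add_le_of_mem_safiArgmin hX hlam hΛ hz hw.1
  have h2 := hw.2 z hz.1
  have h3 : ‖Matrix.toEuclideanLin H (z - w)‖ = 0 := by
    refine pow_eq_zero_iff two_ne_zero |>.1 (le_antisymm (by linarith) (sq_nonneg _))
  have h4 : ‖z - w‖ ≤ 0 := by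
    have := hcH (z - w)
    rw [h3] at this
    exact nonpos_of_mul_nonpos_right this hc
  exact sub_eq_zero.1 (norm_le_zero_iff.1 h4)

/-- Minimizers depend on the weights in a Lipschitz way. -/
theorem exists_norm_safiUpdate_sub_le (hXclosed : IsClosed X) (hX : Convex ℝ X)
    (hXne : X.Nonempty) (hH : IsUnit H) (hlam : 0 ≤ lam) (hΛ : ∀ x c i, 0 ≤ Λ x c i) :
    ∃ C, ∀ x x', ‖safiUpdate X H y lam W Λ x - safiUpdate X H y lam W Λ x'‖ ≤
      C * ∑ c, ∑ i, |Λ x c i - Λ x' c i| := by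
  obtain ⟨m, hm, hmH⟩ := exists_pos_mul_norm_le hH
  let B : Fin NC → ℝ := fun c => ‖LinearMap.toContinuousLinearMap (Matrix.toEuclideanLin (W c))‖
  have hWB : ∀ c i z, |Matrix.toEuclideanLin (W c) z i| ≤ (∑ d, B d) * ‖z‖ := by
    intro c i z
    have h1 := PiLp.norm_apply_le (Matrix.toEuclideanLin (W c) z) i
    have h2 := (LinearMap.toContinuousLinearMap (Matrix.toEuclideanLin (W c))).le_opNorm z
    have h3 : B c ≤ ∑ d, B d :=
      Finset.single_le_sum (f := B) (fun d _ => norm_nonneg _) (Finset.mem_univ c)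
    exact h1.trans (h2.trans (mul_le_mul_of_nonneg_right h3 (norm_nonneg z)))
  refine ⟨2 * lam * (∑ d, B d) / m ^ 2, fun x x' => ?_⟩
  have hz := safiUpdate_mem_safiArgmin (y := y) (W := W) hXclosed hXne hH hlam hΛ x
  have hz' := safiUpdate_mem_safiArgmin (y := y) (W := W) hXclosed hXne hH hlam hΛ x'
  set z := safiUpdate X H y lam W Λ x
  set z' := safiUpdate X H y lam W Λ x'
  set S := ∑ c, ∑ i, |Λ x c i - Λ x' c i|
  -- In the sum of these two growth bounds the data terms cancel, leaving only differences of
  -- weights times differences of `|W_c z|`.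
  have h1 := safiObjective_add_le_of_mem_safiArgmin hX hlam hΛ hz hz'.1
  have h2 := safiObjective_add_le_of_mem_safiArgmin hX hlam hΛ hz' hz.1
  rw [← neg_sub z z', map_neg, norm_neg] at h2
  have hsum : (∑ c, ∑ i, Λ x c i * |Matrix.toEuclideanLin (W c) z' i|
        - ∑ c, ∑ i, Λ x c i * |Matrix.toEuclideanLin (W c) z i|)
      - (∑ c, ∑ i, Λ x' c i * |Matrix.toEuclideanLin (W c) z' i|
        - ∑ c, ∑ i, Λ x' c i * |Matrix.toEuclideanLin (W c) z i|) ≤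
      S * ((∑ d, B d) * ‖z - z'‖) := by
    simp only [S, ← Finset.sum_sub_distrib, Finset.sum_mul]
    refine Finset.sum_le_sum fun c _ => Finset.sum_le_sum fun i _ => ?_
    have e : |(|Matrix.toEuclideanLin (W c) z' i| - |Matrix.toEuclideanLin (W c) z i|)| ≤
        (∑ d, B d) * ‖z - z'‖ := by
      refine (abs_abs_sub_abs_le_abs_sub _ _).trans ?_
      rw [abs_sub_comm, ← PiLp.sub_apply, ← map_sub]
      exact hWB c i _
    have := mul_le_mul_of_nonneg_left e (abs_nonneg (Λ x c i - Λ x' c i))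
    rw [← abs_mul] at this
    rw [Finset.sum_mul] at this
    refine le_trans (le_of_eq ?_) ((le_abs_self _).trans this)
    ring
  have hmz := hmH (z - z')
  have hsq : (m * ‖z - z'‖) ^ 2 ≤ ‖Matrix.toEuclideanLin H (z - z')‖ ^ 2 := by gcongr
  have hkey : m ^ 2 * ‖z - z'‖ ^ 2 ≤ 2 * lam * (∑ d, B d) * S * ‖z - z'‖ := by
    unfold safiObjective at h1 h2
    have := mul_le_mul_of_nonneg_left hsum hlam
    nlinarith
  rcases (norm_nonneg (z - z')).eq_or_lt with h0 | h0
  · rw [← h0]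
    positivity
  · rw [div_mul_eq_mul_div, le_div_iff₀ (by positivity)]
    refine le_of_mul_le_mul_right ?_ h0
    linarith

theorem continuous_safiUpdate (hXclosed : IsClosed X) (hX : Convex ℝ X)
    (hXne : X.Nonempty) (hH : IsUnit H) (hlam : 0 ≤ lam) (hΛcont : Continuous Λ)
    (hΛ : ∀ x c i, 0 ≤ Λ x c i) : Continuous (safiUpdate X H y lam W Λ) := by
  obtain ⟨C, hC⟩ := exists_norm_safiUpdate_sub_le (y := y) (W := W) hXclosed hX hXne hH hlam hΛ
  refine continuous_iff_continuousAt.2 fun x => ?_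
  rw [ContinuousAt, tendsto_iff_norm_sub_tendsto_zero]
  refine squeeze_zero (fun _ => norm_nonneg _) (fun x' => hC x' x) ?_
  have : Continuous fun x' => C * ∑ c, ∑ i, |Λ x' c i - Λ x c i| := by fun_prop
  simpa using this.tendsto x

/-- The update operator has bounded range. -/
theorem exists_norm_safiUpdate_le (hXclosed : IsClosed X) (hXne : X.Nonempty) (hH : IsUnit H)
    (hlam : 0 ≤ lam) (hΛ : ∀ x c i, Λ x c i ∈ Icc (0 : ℝ) 1) :
    ∃ R, ∀ x, ‖safiUpdate X H y lam W Λ x‖ ≤ R := by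
  obtain ⟨m, hm, hmH⟩ := exists_pos_mul_norm_le hH
  obtain ⟨x₀, hx₀⟩ := hXne
  have hΛ0 : ∀ x c i, 0 ≤ Λ x c i := fun x c i => (hΛ x c i).1
  -- All weights are replaced by 1, so the bound does not depend on `x`.
  let J := 1 / 2 * ‖Matrix.toEuclideanLin H x₀ - y‖ ^ 2
    + lam * ∑ c, ∑ i, |Matrix.toEuclideanLin (W c) x₀ i|
  have hJ0 : 0 ≤ J := by positivity
  refine ⟨(‖y‖ + √(2 * J)) / m, fun x => ?_⟩
  have hz := safiUpdate_mem_safiArgmin (y := y) (W := W) hXclosed ⟨x₀, hx₀⟩ hH hlam hΛ0 x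
  have hle : safiObjective H y lam W Λ (safiUpdate X H y lam W Λ x) x ≤ J := by
    refine (hz.2 x₀ hx₀).trans ?_
    unfold safiObjective
    refine add_le_add le_rfl (mul_le_mul_of_nonneg_left ?_ hlam)
    exact Finset.sum_le_sum fun c _ => Finset.sum_le_sum fun i _ =>
      mul_le_of_le_one_left (abs_nonneg _) (hΛ x c i).2
  have := norm_apply_le_of_safiObjective_le (H := H) (y := y) (W := W)
    (z := safiUpdate X H y lam W Λ x) (x := x) hlam hΛ0 (M := √(2 * J)) (by
    rw [Real.sq_sqrt (by positivity)]
    linarith) (Real.sqrt_nonneg _)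
  rw [le_div_iff₀ hm]
  linarith [hmH (safiUpdate X H y lam W Λ x)]

/-- If the origin is admissible, the update operator maps into a ball of explicit radius. -/
theorem norm_safiUpdate_le_of_zero_mem (hXclosed : IsClosed X) (h0 : 0 ∈ X) (hH : IsUnit H)
    (hlam : 0 ≤ lam) (hΛ : ∀ x c i, 0 ≤ Λ x c i) (x : EuclideanSpace ℝ (Fin N)) :
    ‖safiUpdate X H y lam W Λ x‖ ≤ 2 * ‖y‖ / sigmaMin H := by
  -- For `N = 0` the radius is a division by zero, with value 0, and the space is a single point.
  rcases Nat.eq_zero_or_pos N with rfl | hN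
  · rw [Subsingleton.elim (safiUpdate X H y lam W Λ x) 0, norm_zero]
    exact div_nonneg (by positivity) sigmaMin_nonneg
  have : NeZero N := ⟨hN.ne'⟩
  have hz := safiUpdate_mem_safiArgmin (y := y) (W := W) hXclosed ⟨0, h0⟩ hH hlam hΛ x
  have hle := hz.2 0 h0
  have hJ : safiObjective H y lam W Λ 0 x = 1 / 2 * ‖y‖ ^ 2 := by simp [safiObjective]
  rw [hJ] at hle
  have := norm_apply_le_of_safiObjective_le hlam hΛ hle (norm_nonneg y)
  rw [le_div_iff₀ (sigmaMin_pos hH)]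
  linarith [sigmaMin_mul_norm_le (H := H) (safiUpdate X H y lam W Λ x)]

end Objective

/-- The conjuncts say: the update operator `T` is well defined (every subproblem on `X` has `T x`
as its one and only minimizer) and maps `X` to `X`; if `0 ∈ X`, it maps `X` into the ball of
radius `2‖y‖/σ_min` around `0`; it is continuous on `X`; it has a fixed point in `X`. -/
theorem theorem3p4 {N NC : ℕ} (X : Set (EuclideanSpace ℝ (Fin N))) (hXclosed : IsClosed X)
    (hXconvex : Convex ℝ X) (hXne : X.Nonempty)
    (H : Matrix (Fin N) (Fin N) ℝ) (hH : IsUnit H)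
    (y : EuclideanSpace ℝ (Fin N)) (lam : ℝ) (hlam : 0 < lam)
    (W : Fin NC → Matrix (Fin N) (Fin N) ℝ)
    (Λ : EuclideanSpace ℝ (Fin N) → Fin NC → Fin N → ℝ) (hΛcont : Continuous Λ)
    (hΛ : ∀ x c i, Λ x c i ∈ Set.Icc (0 : ℝ) 1) :
    (∀ x ∈ X, safiArgmin X H y lam W Λ x = {safiUpdate X H y lam W Λ x}) ∧
    Set.MapsTo (safiUpdate X H y lam W Λ) X X ∧
    (0 ∈ X → Set.MapsTo (safiUpdate X H y lam W Λ) X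
      (Metric.closedBall 0 (2 * ‖y‖ / sigmaMin H))) ∧
    ContinuousOn (safiUpdate X H y lam W Λ) X ∧
    ∃ x ∈ X, Function.IsFixedPt (safiUpdate X H y lam W Λ) x := by
  have hΛ0 : ∀ x c i, 0 ≤ Λ x c i := fun x c i => (hΛ x c i).1
  have hmem := safiUpdate_mem_safiArgmin (y := y) (W := W) hXclosed hXne hH hlam.le hΛ0
  have hcont := continuous_safiUpdate (y := y) (W := W) hXclosed hXconvex hXne hH hlam.le hΛcont hΛ0
  refine ⟨fun x _ => ?_, fun x _ => (hmem x).1, fun h0 x _ => ?_, hcont.continuousOn, ?_⟩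
  · exact Set.eq_singleton_iff_unique_mem.2
      ⟨hmem x, fun z hz => eq_of_mem_safiArgmin hXconvex hH hlam.le hΛ0 hz (hmem x)⟩
  · rw [mem_closedBall_zero_iff]
    exact norm_safiUpdate_le_of_zero_mem hXclosed h0 hH hlam.le hΛ0 x
  · obtain ⟨R, hR⟩ := exists_norm_safiUpdate_le (y := y) (W := W) hXclosed hXne hH hlam.le hΛ
    obtain ⟨x, hx⟩ := exists_isFixedPt_of_continuous_of_norm_le hcont hR
    exact ⟨x, hx ▸ (hmem x).1, hx⟩
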